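/- **Computational model.** Algorithms are deterministic programs of the unit-cost word RAM whose words have $w=O(\log n)$ bits (a program comes with a constant $c$ and has to work for every word size $w\ge c\log_2(n+1)$). "Combinatorial algorithm" (informally: an algorithm that does not use fast matrix multiplication) has no formal definition; throughout, the combinatorial algorithms are the members of an arbitrary fixed class $\mathcal C$ of word-RAM programs that is closed under constant-size recodings of input and output: if $A\in\mathcal C$, then $\mathcal C$ also contains the program that runs $A$ while replacing each access to the $j$-th input word by a fixed loop-free and branch-free expression of constant size in $j$ and words of the actual input, and replacing the output word by a fixed expression of constant size in that word and words of the actual input. **Combinatorial $q$-Clique Hypothesis** ($q\ge 3$ a constant). For no constant $\varepsilon>0$ is there a combinatorial algorithm that decides in $O(n^{q-\varepsilon})$ time whether an undirected $n$-vertex graph, given by its adjacency matrix, contains a $q$-clique. **$n$-Pairs Minimum Distance.** Given an unweighted undirected simple graph with $n\ge 1$ vertices and $m\ge n$ edges (as a list of edges) and at least one and at most $Cn$ vertex pairs $(s_i,t_i)$, where $C\ge 1$ is a constant integer, the $n$-pairs minimum distance is $x=\min_i d(s_i,t_i)\in\{0,1,2,\dots\}\cup\{\infty\}$. An $\alpha$-approximation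 is an output $\hat x\in\{0,1,2,\dots\}\cup\{\infty\}$ with $x\le\hat x\le\alpha x$ (and $\hat x=\infty$ if and only if $x=\infty$). **Statement.** Let $k\ge 1$ be an integer and assume the Combinatorial $(4k+2)$-Clique Hypothesis. Then for all constants $C\ge1$, $\varepsilon>0$ and $\alpha<1+\frac{1}{k+0.5}$ there is no combinatorial $\alpha$-approximation algorithm for unweighted undirected $n$-Pairs Minimum Distance that runs in time $$O\big(n^{2-\varepsilon}\big),\quad\text{nor}\quad O\big(m\cdot n^{1-1/(2k+1)-\varepsilon}\big),\quad\text{nor}\quad O\big(m^{2-3/(k+2)}\cdot n^{2/(k+2)-\varepsilon}\big).$$ The first bound is excluded even with time linear in $m$ allowed in addition: there is no such algorithm with running time $O(m+n^{2-\varepsilon})$. -/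

import Mathlib

/-! ### The word RAM

All words are natural numbers below `2 ^ w`, where `w` is the word size.  The machine has registers,
a random-access memory of `2 ^ w` cells, and random access to the read-only words of its input. -/

/-- The unit-cost binary operations on words. -/
inductive WordOp
  | add | sub | mul | div | mod | and | or | xor | shl | shr | lt | eq

/-- Word operations; the result is always truncated to `w` bits. -/
def WordOp.eval (w : ℕ) (o : WordOp) (a b : ℕ) : ℕ :=
  (match o with
    | .add => a + b
    | .sub => a + (2 ^ w - b)
    | .mul => a * b
    | .div => a / b
    | .mod => a % b
    | .and => a &&& b
    | .or => a ||| b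
    | .xor => a ^^^ b
    | .shl => a <<< b
    | .shr => a >>> b
    | .lt => if a < b then 1 else 0
    | .eq => if a = b then 1 else 0) % 2 ^ w

/-- Word expressions: a constant, the content of a register, the content of the memory cell or of
the input word whose address is given by an expression, or a word operation. -/
inductive WordExpr
  | const (c : ℕ)
  | reg (i : ℕ)
  | mem (a : WordExpr)
  | input (a : WordExpr)
  | op (o : WordOp) (a b : WordExpr)

/-- The instructions.  A program is a fixed finite list of instructions, so that one instruction of
it performs a number of elementary word operations that is bounded by a constant of the program. -/
inductive Instr
  /-- `set i e`: put the value of `e` into register `i` -/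
  | set (i : ℕ) (e : WordExpr)
  /-- `store a e`: put the value of `e` into the memory cell with address `a` -/
  | store (a e : WordExpr)
  /-- `jz e l`: continue with instruction number `l` if the value of `e` is `0` -/
  | jz (e : WordExpr) (l : ℕ)
  /-- `ret e`: stop and output the value of `e` -/
  | ret (e : WordExpr)

/-- A word-RAM program. -/
abbrev Program := List Instr

/-- Configurations: program counter, registers, memory. -/
structure Config where
  pc : ℕ
  regs : ℕ → ℕ
  mem : ℕ → ℕ

/-- At the start all registers and all memory cells are `0`. -/
def Config.init : Config := ⟨0, fun _ => 0, fun _ => 0⟩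

/-- The value of an expression, for word size `w` and input words `x 0, x 1, …`. -/
def WordExpr.eval (w : ℕ) (x : ℕ → ℕ) (s : Config) : WordExpr → ℕ
  | const c => c % 2 ^ w
  | reg i => s.regs i
  | mem a => s.mem (a.eval w x s)
  | input a => x (a.eval w x s) % 2 ^ w
  | op o a b => o.eval w (a.eval w x s) (b.eval w x s)

/-- `A.exec w x T s = some v`: started in configuration `s`, the program `A` outputs `v` after
executing at most `T` instructions (the final `ret` is counted). -/
def Program.exec (A : Program) (w : ℕ) (x : ℕ → ℕ) : ℕ → Config → Option ℕ
  | 0, _ => none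
  | T + 1, s =>
    match A[s.pc]? with
    | none => none
    | some (.ret e) => some (e.eval w x s)
    | some (.set i e) =>
        Program.exec A w x T
          { s with pc := s.pc + 1, regs := Function.update s.regs i (e.eval w x s) }
    | some (.store a e) =>
        Program.exec A w x T
          { s with pc := s.pc + 1, mem := Function.update s.mem (a.eval w x s) (e.eval w x s) }
    | some (.jz e l) =>
        Program.exec A w x T { s with pc := if e.eval w x s = 0 then l else s.pc + 1 }

/-- On input `x` and with words of `w` bits, `A` stops within `T` steps and outputs `v`. -/
def Program.Outputs (A : Program) (w : ℕ) (x : ℕ → ℕ) (T v : ℕ) : Prop :=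
  A.exec w x T Config.init = some v

/-! ### Classes of combinatorial algorithms

"Combinatorial algorithm" is an informal term.  It is represented by an arbitrary class of programs
that is stable under constant-size recodings of the input and of the output. -/

/-- Constant-size word expressions in one argument and the input words.  They have no registers, no
memory, no loops and no branches. -/
inductive LocalMap
  | arg
  | const (c : ℕ)
  | input (a : LocalMap)
  | op (o : WordOp) (a b : LocalMap)

/-- Replace the argument of a local map by an expression. -/
def LocalMap.inst (e : WordExpr) : LocalMap → WordExpr
  | arg => e
  | const c => .const c
  | input a => .input (a.inst e)
  | op o a b => .op o (a.inst e) (b.inst e)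

/-- Replace every input access "word number `a`" by the local map `f` at `a`. -/
def WordExpr.recode (f : LocalMap) : WordExpr → WordExpr
  | const c => .const c
  | reg i => .reg i
  | mem a => .mem (a.recode f)
  | input a => f.inst (a.recode f)
  | op o a b => .op o (a.recode f) (b.recode f)

/-- Recode the input accesses by `f`, and the output by `h`. -/
def Instr.recode (f h : LocalMap) : Instr → Instr
  | set i e => .set i (e.recode f)
  | store a e => .store (a.recode f) (e.recode f)
  | jz e l => .jz (e.recode f) l
  | ret e => .ret (h.inst (e.recode f))

/-- The program that runs `A` on the virtual input whose `j`-th word is computed on demand, by the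
constant-size expression `f`, from `j` and the words of the real input, and that finally applies the
constant-size expression `h` to the output of `A`. -/
def Program.recode (f h : LocalMap) (A : Program) : Program :=
  A.map (Instr.recode f h)

/-- A class of programs that is stable under constant-size recodings of input and output. -/
def ClosedUnderRecoding (𝒞 : Set Program) : Prop :=
  ∀ A ∈ 𝒞, ∀ f h : LocalMap, A.recode f h ∈ 𝒞

/-! ### Clique detection -/

open Classical in
/-- The input words for a graph on `n` vertices: `n`, and then the adjacency matrix, row by row. -/
noncomputable def encodeGraph {n : ℕ} (G : SimpleGraph (Fin n)) (j : ℕ) : ℕ :=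
  if j = 0 then n
  else if ∃ u v : Fin n, G.Adj u v ∧ j = 1 + u * n + v then 1
  else 0

/-- `A` decides whether a graph on `n ≥ 1` vertices has a `q`-clique, in time `O(t n)` on the word RAM
with words of `O(log n)` bits: for a constant `c`, all word sizes `w` with `w ≥ c log₂ (n + 1)` are
large enough for `A`. -/
def DetectsClique (A : Program) (q : ℕ) (t : ℝ → ℝ) : Prop :=
  ∃ (c : ℕ) (K : ℝ), ∀ n : ℕ, 1 ≤ n → ∀ G : SimpleGraph (Fin n),
    ∀ w : ℕ, (n + 1) ^ c ≤ 2 ^ w →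
      ∃ T v : ℕ, (T : ℝ) ≤ K * t n ∧ A.Outputs w (encodeGraph G) T v ∧
        (v ≠ 0 ↔ ∃ s : Finset (Fin n), G.IsNClique q s)

/-- The `q`-Clique Hypothesis for the programs in `𝒞`: for no constant `ε > 0` does `𝒞` contain a
program that detects `q`-cliques in time `O(n ^ (q - ε))`. -/
def CombinatorialCliqueHypothesis (𝒞 : Set Program) (q : ℕ) : Prop :=
  ∀ ε : ℝ, 0 < ε → ¬ ∃ A ∈ 𝒞, DetectsClique A q (fun n => n ^ ((q : ℝ) - ε))

/-! ### `n`-Pairs Minimum Distance -/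

/-- An unweighted undirected simple graph with `n` vertices and exactly `m` edges, given by the list
of its edges (in any order), together with a list of `p` pairs of vertices. -/
structure PairsInstance where
  n : ℕ
  m : ℕ
  p : ℕ
  edge : Fin m → Fin n × Fin n
  edge_ne : ∀ i, (edge i).1 ≠ (edge i).2
  edge_inj : Function.Injective fun i => s((edge i).1, (edge i).2)
  pair : Fin p → Fin n × Fin n

namespace PairsInstance

/-- The graph of an instance. -/
def graph (I : PairsInstance) : SimpleGraph (Fin I.n) :=
  SimpleGraph.fromRel fun u v => ∃ i, I.edge i = (u, v)

/-- The minimum of the distances of the given pairs; it is `⊤` if no given pair is connected. -/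
noncomputable def minDist (I : PairsInstance) : ℕ∞ :=
  ⨅ i : Fin I.p, I.graph.edist (I.pair i).1 (I.pair i).2

/-- The input words: `n`, `m`, `p`, then the end points of the edges, then the given pairs. -/
def encode (I : PairsInstance) (j : ℕ) : ℕ :=
  if j = 0 then I.n
  else if j = 1 then I.m
  else if j = 2 then I.p
  else if h : (j - 3) / 2 < I.m then
    if (j - 3) % 2 = 0 then ((I.edge ⟨(j - 3) / 2, h⟩).1 : ℕ) else (I.edge ⟨(j - 3) / 2, h⟩).2
  else if h : (j - 3) / 2 - I.m < I.p then
    if (j - 3) % 2 = 0 then ((I.pair ⟨(j - 3) / 2 - I.m, h⟩).1 : ℕ)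
    else (I.pair ⟨(j - 3) / 2 - I.m, h⟩).2
  else 0

end PairsInstance

/-- An output word as an element of `ℕ∞`: `0` stands for `∞`, and `d + 1` stands for `d`. -/
def decodeDist : ℕ → ℕ∞
  | 0 => ⊤
  | d + 1 => d

/-- `y` is an `α`-approximation of `x`, that is `x ≤ y ≤ α x`; for `x = ∞` this means `y = ∞`. -/
def IsApprox (α : ℝ) (x y : ℕ∞) : Prop :=
  x ≤ y ∧ ∀ d : ℕ, x = d → ∃ e : ℕ, y = e ∧ (e : ℝ) ≤ α * d

/-- `A` computes an `α`-approximation of the `n`-pairs minimum distance, in time `O(t n m)` on the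
word RAM with words of `O(log n)` bits (as for clique detection), on all instances with
`1 ≤ n ≤ m` and with at least one and at most `C * n` pairs. -/
def ApproximatesMinDist (A : Program) (C : ℕ) (α : ℝ) (t : ℝ → ℝ → ℝ) : Prop :=
  ∃ (c : ℕ) (K : ℝ), ∀ I : PairsInstance,
    1 ≤ I.n → I.n ≤ I.m → 1 ≤ I.p → I.p ≤ C * I.n →
    ∀ w : ℕ, (I.n + 1) ^ c ≤ 2 ^ w →
      ∃ T v : ℕ, (T : ℝ) ≤ K * t I.n I.m ∧ A.Outputs w I.encode T v ∧
        IsApprox α I.minDist (decodeDist v)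

/-! The proof reduces `(4k+2)`-clique detection to minimum distance in a layered graph. Arrange the
vertices of a clique in a cycle of `2k+1` blocks of two. A node of the layered graph is a layer
among `0, …, 2k+1` with a window of `k` consecutive blocks (`2k` digits). An edge from layer `g` to
layer `g+1` is a window of `k+1` blocks: its tail forgets the last block, its head the first. An
edge counts as good if its `2k+2` vertices are pairwise adjacent. The pairs join each node of layer
0 to its namesake in the last layer.

Climbing all layers moves the window once around the cycle, so a clique yields a pair at distance at
most `2k+1` (`layeredInstance_edist_le_of_isNClique`). Conversely, a path of length `2k+1` through
good edges gives cyclically overlapping windows. Any two of the `2k+1` blocks have cyclic distance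
at most `k`, so they share a window, and all vertices are adjacent (`exists_isNClique_of_overlap`).
Edges join consecutive layers, so pair distances are odd or infinite; without a clique they are at
least `2k+3`. The gap is `(2k+3)/(2k+1) = 1 + 1/(k+0.5)`.

The virtual input must be computable word by word by constant-size expressions, so bad edges cannot
be deleted from the list. Instead the node set is doubled: good edges live in copy 0, which contains
all pairs, and bad edges in copy 1. Thus the edge list has a fixed shape and `eval_encoding` can
produce it. Digits are in base `2n` and read modulo `n`, which leaves room for the size inequalities
even when `n = 1`. The instance has `Θ(n^(2k+1))` vertices, most of them isolated, and `Θ(n^(2k+2))`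
edges; each excluded running time then becomes `O(n^(4k+2-δ))` with `δ > 0`. -/

/-! ### Semantics of recodings -/

/-- The value of a local map at the argument `j`, for word size `w` and input words `x`. -/
def LocalMap.eval (w : ℕ) (x : ℕ → ℕ) (j : ℕ) : LocalMap → ℕ
  | arg => j
  | const c => c % 2 ^ w
  | input a => x (a.eval w x j) % 2 ^ w
  | op o a b => o.eval w (a.eval w x j) (b.eval w x j)

theorem LocalMap.eval_lt {w : ℕ} {x : ℕ → ℕ} {j : ℕ} (hj : j < 2 ^ w) (f : LocalMap) :
    f.eval w x j < 2 ^ w := by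
  cases f with
  | arg => exact hj
  | const c => exact Nat.mod_lt _ (by positivity)
  | input a => exact Nat.mod_lt _ (by positivity)
  | op o a b => exact Nat.mod_lt _ (by positivity)

theorem LocalMap.eval_inst (w : ℕ) (x : ℕ → ℕ) (s : Config) (e : WordExpr) (f : LocalMap) :
    (f.inst e).eval w x s = f.eval w x (e.eval w x s) := by
  induction f with
  | arg => rfl
  | const c => rfl
  | input a ih => simp only [LocalMap.inst, WordExpr.eval, LocalMap.eval, ih]
  | op o a b iha ihb => simp only [LocalMap.inst, WordExpr.eval, LocalMap.eval, iha, ihb]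

/-- All registers and memory cells of the configuration hold words of `w` bits. -/
def Config.Bounded (w : ℕ) (s : Config) : Prop :=
  (∀ i, s.regs i < 2 ^ w) ∧ ∀ i, s.mem i < 2 ^ w

theorem WordExpr.eval_lt {w : ℕ} {x : ℕ → ℕ} {s : Config} (hs : s.Bounded w) (e : WordExpr) :
    e.eval w x s < 2 ^ w := by
  cases e with
  | const c => exact Nat.mod_lt _ (by positivity)
  | reg i => exact hs.1 i
  | mem a => exact hs.2 _
  | input a => exact Nat.mod_lt _ (by positivity)
  | op o a b => exact Nat.mod_lt _ (by positivity)

/-- Boundedness of the configuration keeps every input address below `2 ^ w`, the only range in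
which `f` is assumed correct. -/
theorem WordExpr.eval_recode {w : ℕ} {x y : ℕ → ℕ} {f : LocalMap}
    (hf : ∀ j < 2 ^ w, f.eval w x j = y j % 2 ^ w) {s : Config} (hs : s.Bounded w)
    (e : WordExpr) : (e.recode f).eval w x s = e.eval w y s := by
  induction e with
  | const c => rfl
  | reg i => rfl
  | mem a ih => simp only [WordExpr.recode, WordExpr.eval, ih]
  | input a ih =>
    simp only [WordExpr.recode, WordExpr.eval, LocalMap.eval_inst, ih]
    exact hf _ (WordExpr.eval_lt hs a)
  | op o a b iha ihb => simp only [WordExpr.recode, WordExpr.eval, iha, ihb]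

theorem Function.update_lt {f : ℕ → ℕ} {b : ℕ} (hf : ∀ i, f i < b) (i v : ℕ) (hv : v < b) (j : ℕ) :
    Function.update f i v j < b := by
  rcases eq_or_ne j i with rfl | h
  · simpa using hv
  · simpa [Function.update_of_ne h] using hf j

/-- The two programs run in lockstep, one instruction for one instruction, so recoding costs no
extra steps; only the returned word differs, by `h`. -/
theorem Program.exec_recode {w : ℕ} {x y : ℕ → ℕ} {f : LocalMap} (h : LocalMap)
    (hf : ∀ j < 2 ^ w, f.eval w x j = y j % 2 ^ w) (A : Program) (T : ℕ) :
    ∀ s : Config, s.Bounded w →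
      (A.recode f h).exec w x T s = (A.exec w y T s).map (h.eval w x) := by
  induction T with
  | zero => intro s _; rfl
  | succ T ih =>
    intro s hs
    have hget : (A.recode f h)[s.pc]? = (A[s.pc]?).map (Instr.recode f h) := by
      simp [Program.recode]
    unfold Program.exec
    rw [hget]
    cases hA : A[s.pc]? with
    | none => rfl
    | some I =>
      cases I with
      | set i e =>
        simp only [Option.map_some, Instr.recode, WordExpr.eval_recode hf hs]
        exact ih _ ⟨Function.update_lt hs.1 _ _ (WordExpr.eval_lt hs e), hs.2⟩
      | store a e =>
        simp only [Option.map_some, Instr.recode, WordExpr.eval_recode hf hs]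
        exact ih _ ⟨hs.1, Function.update_lt hs.2 _ _ (WordExpr.eval_lt hs e)⟩
      | jz e l =>
        simp only [Option.map_some, Instr.recode, WordExpr.eval_recode hf hs]
        exact ih _ hs
      | ret e =>
        simp only [Option.map_some, Instr.recode, LocalMap.eval_inst,
          WordExpr.eval_recode hf hs]

theorem Program.Outputs.recode {w : ℕ} {x y : ℕ → ℕ} {f : LocalMap} (h : LocalMap)
    (hf : ∀ j < 2 ^ w, f.eval w x j = y j % 2 ^ w) {A : Program} {T v : ℕ}
    (hA : A.Outputs w y T v) : (A.recode f h).Outputs w x T (h.eval w x v) := by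
  have hs : Config.init.Bounded w := ⟨fun _ => by simp [Config.init], fun _ => by simp [Config.init]⟩
  unfold Program.Outputs at hA ⊢
  rw [Program.exec_recode h hf A T _ hs, hA]
  rfl

/-! ### Walks in layered graphs -/

theorem SimpleGraph.Walk.layer_bounds {V : Type*} {G : SimpleGraph V} {L : V → ℕ}
    (hL : ∀ a b, G.Adj a b → L b = L a + 1 ∨ L a = L b + 1) {s t : V} (p : G.Walk s t) :
    L t ≤ L s + p.length ∧ (L s + L t + p.length) % 2 = 0 := by
  induction p with
  | nil => simp; omega
  | cons h p ih =>
    rw [SimpleGraph.Walk.length_cons]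
    have := hL _ _ h
    omega

/-- Neither the first `i` steps nor the rest can climb more layers than their length; as the total
climb equals the total length, both parts climb at every step. -/
theorem SimpleGraph.Walk.layer_getVert {V : Type*} {G : SimpleGraph V} {L : V → ℕ}
    (hL : ∀ a b, G.Adj a b → L b = L a + 1 ∨ L a = L b + 1) {s t : V} (p : G.Walk s t)
    (hp : L t = L s + p.length) {i : ℕ} (hi : i ≤ p.length) : L (p.getVert i) = L s + i := by
  have h1 := (p.take i).layer_bounds hL
  have h2 := (p.drop i).layer_bounds hL
  rw [SimpleGraph.Walk.take_length] at h1
  rw [SimpleGraph.Walk.drop_length] at h2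
  omega

/-! ### Numbers as sequences of digits -/

/-- The number whose digits in base `b`, from the least significant one, are
`z a, z (a + 1), …, z (a + l - 1)`. -/
def digitNum (b : ℕ) (z : ℕ → ℕ) : ℕ → ℕ → ℕ
  | _, 0 => 0
  | a, l + 1 => z a + b * digitNum b z (a + 1) l

section digitNum

variable {b : ℕ} {z : ℕ → ℕ}

theorem digitNum_lt (hz : ∀ i, z i < b) (a l : ℕ) : digitNum b z a l < b ^ l := by
  induction l generalizing a with
  | zero => simp [digitNum]
  | succ l ih =>
    have h1 := ih (a + 1)
    have h2 : b * (digitNum b z (a + 1) l + 1) ≤ b * b ^ l := Nat.mul_le_mul_left _ h1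
    have := hz a
    rw [digitNum, pow_succ']
    rw [mul_add] at h2
    omega

theorem digitNum_add (a i l : ℕ) :
    digitNum b z a (i + l) = digitNum b z a i + b ^ i * digitNum b z (a + i) l := by
  induction i generalizing a with
  | zero => simp [digitNum]
  | succ i ih =>
    rw [show i + 1 + l = (i + l) + 1 by ring, digitNum, ih, digitNum,
      show a + 1 + i = a + (i + 1) by ring]
    ring

theorem digitNum_mod (hz : ∀ i, z i < b) (a : ℕ) {i l : ℕ} (hi : i ≤ l) :
    digitNum b z a l % b ^ i = digitNum b z a i := by
  obtain ⟨l, rfl⟩ := Nat.exists_eq_add_of_le hi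
  rw [digitNum_add, Nat.add_mul_mod_self_left, Nat.mod_eq_of_lt (digitNum_lt hz a i)]

theorem digitNum_div (hz : ∀ i, z i < b) (a i l : ℕ) :
    digitNum b z a (i + l) / b ^ i = digitNum b z (a + i) l := by
  rw [digitNum_add, Nat.add_mul_div_left _ _ ((Nat.zero_le _).trans_lt (digitNum_lt hz a i)),
    Nat.div_eq_of_lt (digitNum_lt hz a i), zero_add]

theorem digitNum_digit (hz : ∀ i, z i < b) (a : ℕ) {i l : ℕ} (hi : i < l) :
    digitNum b z a l / b ^ i % b = z (a + i) := by
  obtain ⟨l, rfl⟩ := Nat.exists_eq_add_of_lt hi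
  rw [show i + l + 1 = i + (l + 1) by ring, digitNum_div hz, digitNum, Nat.add_mul_mod_self_left,
    Nat.mod_eq_of_lt (hz _)]

theorem digitNum_periodic {q : ℕ} (hz : ∀ i, z (i + q) = z i) (a l : ℕ) :
    digitNum b z (a + q) l = digitNum b z a l := by
  induction l generalizing a with
  | zero => rfl
  | succ l ih => rw [digitNum, digitNum, hz, show a + q + 1 = a + 1 + q by ring, ih]

end digitNum

/-- The digits of a cyclic sequence of numbers whose windows of `k + 1` digits overlap. -/
theorem div_pow_mod_of_overlap {Q k : ℕ} {t : ℕ → ℕ} (ht : ∀ g, t g / Q = t (g + 1) % Q ^ k)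
    {h : ℕ} (hh : h ≤ k) (g : ℕ) : t g / Q ^ h % Q = t (g + h) % Q := by
  induction h generalizing g with
  | zero => simp
  | succ h ih =>
    obtain ⟨l, rfl⟩ := Nat.exists_eq_add_of_lt (show h < k by omega)
    rw [pow_succ', ← Nat.div_div_eq_div_mul, ht, show g + (h + 1) = (g + 1) + h by ring,
      ← ih (by omega)]
    rw [show h + l + 1 = h + (l + 1) by ring, pow_add, Nat.mod_mul_right_div_self,
      pow_succ', Nat.mod_mul_right_mod]

/-! ### The layered graph of a graph -/

/-- Adjacency of vertices that are given by their numbers. -/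
def SimpleGraph.AdjNat {n : ℕ} (G : SimpleGraph (Fin n)) (a b : ℕ) : Prop :=
  ∃ (ha : a < n) (hb : b < n), G.Adj ⟨a, ha⟩ ⟨b, hb⟩

theorem SimpleGraph.AdjNat.symm {n : ℕ} {G : SimpleGraph (Fin n)} {a b : ℕ} (h : G.AdjNat a b) :
    G.AdjNat b a :=
  ⟨h.2.1, h.1, h.2.2.symm⟩

/-- The first `l` digits of `t` in base `2 * n`, modulo `n`, are pairwise adjacent in `G`. -/
def SimpleGraph.IsCliqueCode {n : ℕ} (G : SimpleGraph (Fin n)) (l t : ℕ) : Prop :=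
  ∀ i j, i < j → j < l → G.AdjNat (t / (2 * n) ^ i % n) (t / (2 * n) ^ j % n)

open Classical in
/-- `0` if `t` is the code of a clique, and `1` otherwise. -/
noncomputable def SimpleGraph.defect {n : ℕ} (G : SimpleGraph (Fin n)) (l t : ℕ) : ℕ :=
  if G.IsCliqueCode l t then 0 else 1

theorem SimpleGraph.defect_le_one {n : ℕ} (G : SimpleGraph (Fin n)) (l t : ℕ) :
    G.defect l t ≤ 1 := by
  unfold SimpleGraph.defect; split_ifs <;> omega

/-- The node number `x < M` of layer `g < r` in the copy `b` of a layered vertex set. -/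
def layerNode (r M b g x : ℕ) : ℕ := (b * r + g) * M + x

section layerNode

variable {r M b g x : ℕ}

theorem layerNode_lt (hb : b ≤ 1) (hg : g < r) (hx : x < M) : layerNode r M b g x < 2 * r * M := by
  have h1 : b * r ≤ 1 * r := Nat.mul_le_mul_right _ hb
  have h2 : (b * r + g + 1) * M ≤ (2 * r) * M := Nat.mul_le_mul_right _ (by omega)
  unfold layerNode
  rw [add_mul _ 1, one_mul] at h2
  omega

theorem layerNode_div (hx : x < M) : layerNode r M b g x / M = b * r + g := by
  unfold layerNode
  rw [mul_comm, Nat.mul_add_div (by omega), Nat.div_eq_of_lt hx, add_zero]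

theorem layerNode_mod (hx : x < M) : layerNode r M b g x % M = x := by
  unfold layerNode
  rw [mul_comm, Nat.mul_add_mod, Nat.mod_eq_of_lt hx]

theorem layerNode_layer (hg : g < r) (hx : x < M) : layerNode r M b g x / M % r = g := by
  rw [layerNode_div hx, mul_comm, Nat.mul_add_mod, Nat.mod_eq_of_lt hg]

theorem layerNode_copy (hg : g < r) (hx : x < M) : layerNode r M b g x / M / r = b := by
  rw [layerNode_div hx, mul_comm, Nat.mul_add_div (by omega), Nat.div_eq_of_lt hg, add_zero]

end layerNode

namespace SimpleGraph

variable {n : ℕ} (G : SimpleGraph (Fin n)) (k : ℕ)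

/-- The node in the lower layer of edge number `e` of the layered graph. -/
noncomputable def layeredTail (e : ℕ) : ℕ :=
  layerNode (2 * k + 2) ((2 * n) ^ (2 * k)) (G.defect (2 * k + 2) (e % (2 * n) ^ (2 * k + 2)))
    (e / (2 * n) ^ (2 * k + 2)) (e % (2 * n) ^ (2 * k + 2) % (2 * n) ^ (2 * k))

/-- The node in the upper layer of edge number `e` of the layered graph. -/
noncomputable def layeredHead (e : ℕ) : ℕ :=
  layerNode (2 * k + 2) ((2 * n) ^ (2 * k)) (G.defect (2 * k + 2) (e % (2 * n) ^ (2 * k + 2)))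
    (e / (2 * n) ^ (2 * k + 2) + 1) (e % (2 * n) ^ (2 * k + 2) / (2 * n) ^ 2)

theorem layeredTail_index_lt (hn : 1 ≤ n) (e : ℕ) :
    e % (2 * n) ^ (2 * k + 2) % (2 * n) ^ (2 * k) < (2 * n) ^ (2 * k) :=
  Nat.mod_lt _ (by positivity)

theorem layeredHead_index_lt (hn : 1 ≤ n) (e : ℕ) :
    e % (2 * n) ^ (2 * k + 2) / (2 * n) ^ 2 < (2 * n) ^ (2 * k) := by
  rw [Nat.div_lt_iff_lt_mul (by positivity), ← pow_add]
  exact Nat.mod_lt _ (by positivity)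

theorem layered_gap_lt {e : ℕ} (he : e < (2 * k + 1) * (2 * n) ^ (2 * k + 2)) :
    e / (2 * n) ^ (2 * k + 2) < 2 * k + 1 :=
  Nat.div_lt_of_lt_mul (by rwa [mul_comm])

theorem layered_card_le (hn : 1 ≤ n) :
    2 * (2 * k + 2) * (2 * n) ^ (2 * k) ≤ (2 * k + 2) * (2 * n) ^ (2 * k + 1) := by
  calc 2 * (2 * k + 2) * (2 * n) ^ (2 * k) = (2 * k + 2) * ((2 * n) ^ (2 * k) * (2 * 1)) := by ring
    _ ≤ (2 * k + 2) * ((2 * n) ^ (2 * k) * (2 * n)) := by gcongr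
    _ = _ := by rw [pow_succ]

theorem layeredTail_lt (hn : 1 ≤ n) {e : ℕ} (he : e < (2 * k + 1) * (2 * n) ^ (2 * k + 2)) :
    G.layeredTail k e < 2 * (2 * k + 2) * (2 * n) ^ (2 * k) :=
  layerNode_lt (G.defect_le_one _ _) (by have := layered_gap_lt k he; omega)
    (layeredTail_index_lt k hn e)

theorem layeredHead_lt (hn : 1 ≤ n) {e : ℕ} (he : e < (2 * k + 1) * (2 * n) ^ (2 * k + 2)) :
    G.layeredHead k e < 2 * (2 * k + 2) * (2 * n) ^ (2 * k) :=
  layerNode_lt (G.defect_le_one _ _) (by have := layered_gap_lt k he; omega)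
    (layeredHead_index_lt k hn e)

theorem layeredTail_layer (hn : 1 ≤ n) {e : ℕ} (he : e < (2 * k + 1) * (2 * n) ^ (2 * k + 2)) :
    G.layeredTail k e / (2 * n) ^ (2 * k) % (2 * k + 2) = e / (2 * n) ^ (2 * k + 2) :=
  layerNode_layer (by have := layered_gap_lt k he; omega) (layeredTail_index_lt k hn e)

theorem layeredHead_layer (hn : 1 ≤ n) {e : ℕ} (he : e < (2 * k + 1) * (2 * n) ^ (2 * k + 2)) :
    G.layeredHead k e / (2 * n) ^ (2 * k) % (2 * k + 2) = e / (2 * n) ^ (2 * k + 2) + 1 :=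
  layerNode_layer (by have := layered_gap_lt k he; omega) (layeredHead_index_lt k hn e)

theorem layeredTail_mod (hn : 1 ≤ n) (e : ℕ) : G.layeredTail k e % (2 * n) ^ (2 * k) =
    e % (2 * n) ^ (2 * k + 2) % (2 * n) ^ (2 * k) :=
  layerNode_mod (layeredTail_index_lt k hn e)

theorem layeredHead_mod (hn : 1 ≤ n) (e : ℕ) : G.layeredHead k e % (2 * n) ^ (2 * k) =
    e % (2 * n) ^ (2 * k + 2) / (2 * n) ^ 2 :=
  layerNode_mod (layeredHead_index_lt k hn e)

theorem layeredTail_copy (hn : 1 ≤ n) {e : ℕ} (he : e < (2 * k + 1) * (2 * n) ^ (2 * k + 2)) :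
    G.layeredTail k e / (2 * n) ^ (2 * k) / (2 * k + 2) =
      G.defect (2 * k + 2) (e % (2 * n) ^ (2 * k + 2)) :=
  layerNode_copy (by have := layered_gap_lt k he; omega) (layeredTail_index_lt k hn e)

theorem layeredHead_copy (hn : 1 ≤ n) {e : ℕ} (he : e < (2 * k + 1) * (2 * n) ^ (2 * k + 2)) :
    G.layeredHead k e / (2 * n) ^ (2 * k) / (2 * k + 2) =
      G.defect (2 * k + 2) (e % (2 * n) ^ (2 * k + 2)) :=
  layerNode_copy (by have := layered_gap_lt k he; omega) (layeredHead_index_lt k hn e)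

/-- The tail records the layer and the low `2k` digits of the code, the head its high `2k` digits.
Since `2k ≥ 2`, together they cover all `2k+2` digits. -/
theorem eq_of_layeredTail_eq_of_layeredHead_eq (hk : 1 ≤ k) (hn : 1 ≤ n) {e e' : ℕ}
    (he : e < (2 * k + 1) * (2 * n) ^ (2 * k + 2)) (he' : e' < (2 * k + 1) * (2 * n) ^ (2 * k + 2))
    (h1 : G.layeredTail k e = G.layeredTail k e') (h2 : G.layeredHead k e = G.layeredHead k e') :
    e = e' := by
  have hg := G.layeredTail_layer k hn he
  rw [h1, G.layeredTail_layer k hn he'] at hg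
  have hx := G.layeredTail_mod k hn e
  rw [h1, G.layeredTail_mod k hn e'] at hx
  have hy := G.layeredHead_mod k hn e
  rw [h2, G.layeredHead_mod k hn e'] at hy
  have key : ∀ t : ℕ, t = t % (2 * n) ^ (2 * k) +
      (2 * n) ^ (2 * k) * (t / (2 * n) ^ 2 / (2 * n) ^ (2 * k - 2)) := by
    intro t
    rw [Nat.div_div_eq_div_mul, ← pow_add, show 2 + (2 * k - 2) = 2 * k by omega, Nat.mod_add_div]
  have ht : e % (2 * n) ^ (2 * k + 2) = e' % (2 * n) ^ (2 * k + 2) := by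
    rw [key (e % _), key (e' % _), hx, hy]
  rw [← Nat.mod_add_div e ((2 * n) ^ (2 * k + 2)), ht, ← hg, Nat.mod_add_div]

/-- The layered graph of `G`, with the copies of the nodes of the first layer in the last layer as
their partners, as an instance of `n`-Pairs Minimum Distance. -/
noncomputable def layeredInstance (hk : 1 ≤ k) (hn : 1 ≤ n) : PairsInstance where
  -- The two copies use only `2 * (2k+2) * (2n)^(2k)` numbers; the surplus consists of isolated
  -- vertices and tunes the vertex count to the time bounds.
  n := (2 * k + 2) * (2 * n) ^ (2 * k + 1)
  m := (2 * k + 1) * (2 * n) ^ (2 * k + 2)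
  p := (2 * n) ^ (2 * k)
  edge e := (⟨G.layeredTail k e, (G.layeredTail_lt k hn e.2).trans_le (layered_card_le k hn)⟩,
    ⟨G.layeredHead k e, (G.layeredHead_lt k hn e.2).trans_le (layered_card_le k hn)⟩)
  edge_ne e h := by
    have h1 := G.layeredTail_layer k hn e.2
    have h2 := G.layeredHead_layer k hn e.2
    rw [Fin.mk.injEq] at h
    rw [h] at h1
    omega
  edge_inj e e' h := by
    rcases Sym2.eq_iff.1 h with ⟨h1, h2⟩ | ⟨h1, h2⟩
    · rw [Fin.mk.injEq] at h1 h2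
      exact Fin.ext (G.eq_of_layeredTail_eq_of_layeredHead_eq k hk hn e.2 e'.2 h1 h2)
    · rw [Fin.mk.injEq] at h1 h2
      -- Opposite orientations are impossible: the layers would satisfy `g = g' + 1` and `g + 1 =
      -- g'`.
      have a1 := G.layeredTail_layer k hn e.2
      have a2 := G.layeredHead_layer k hn e.2
      have a3 := G.layeredTail_layer k hn e'.2
      have a4 := G.layeredHead_layer k hn e'.2
      rw [h1] at a1
      rw [h2] at a2
      omega
  pair x := (⟨layerNode (2 * k + 2) ((2 * n) ^ (2 * k)) 0 0 x,
      (layerNode_lt (by omega) (by omega) x.2).trans_le (layered_card_le k hn)⟩,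
    ⟨layerNode (2 * k + 2) ((2 * n) ^ (2 * k)) 0 (2 * k + 1) x,
      (layerNode_lt (by omega) (by omega) x.2).trans_le (layered_card_le k hn)⟩)

theorem layeredInstance_n_le_m (hk : 1 ≤ k) (hn : 1 ≤ n) :
    (G.layeredInstance k hk hn).n ≤ (G.layeredInstance k hk hn).m := by
  change (2 * k + 2) * (2 * n) ^ (2 * k + 1) ≤ (2 * k + 1) * (2 * n) ^ (2 * k + 2)
  calc (2 * k + 2) * (2 * n) ^ (2 * k + 1) ≤ ((2 * k + 1) * (2 * n)) * (2 * n) ^ (2 * k + 1) := by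
        gcongr; nlinarith
    _ = _ := by ring

theorem layeredInstance_p_le_n (hk : 1 ≤ k) (hn : 1 ≤ n) :
    (G.layeredInstance k hk hn).p ≤ (G.layeredInstance k hk hn).n := by
  change (2 * n) ^ (2 * k) ≤ (2 * k + 2) * (2 * n) ^ (2 * k + 1)
  have := layered_card_le (n := n) k hn
  nlinarith [Nat.zero_le ((2 * n) ^ (2 * k))]

theorem layeredInstance_adj (hk : 1 ≤ k) (hn : 1 ≤ n)
    {a b : Fin (G.layeredInstance k hk hn).n} :
    (G.layeredInstance k hk hn).graph.Adj a b → ∃ e < (2 * k + 1) * (2 * n) ^ (2 * k + 2),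
      ((a : ℕ) = G.layeredTail k e ∧ (b : ℕ) = G.layeredHead k e) ∨
      ((b : ℕ) = G.layeredTail k e ∧ (a : ℕ) = G.layeredHead k e) := by
  rintro ⟨-, ⟨e, he⟩ | ⟨e, he⟩⟩
  · exact ⟨e, e.2, Or.inl ⟨(congrArg (fun q => (q.1 : ℕ)) he).symm,
      (congrArg (fun q => (q.2 : ℕ)) he).symm⟩⟩
  · exact ⟨e, e.2, Or.inr ⟨(congrArg (fun q => (q.1 : ℕ)) he).symm,
      (congrArg (fun q => (q.2 : ℕ)) he).symm⟩⟩

theorem layeredInstance_adj_of_edge (hk : 1 ≤ k) (hn : 1 ≤ n)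
    {a b : Fin (G.layeredInstance k hk hn).n} {e : ℕ}
    (he : e < (2 * k + 1) * (2 * n) ^ (2 * k + 2)) (ha : (a : ℕ) = G.layeredTail k e)
    (hb : (b : ℕ) = G.layeredHead k e) : (G.layeredInstance k hk hn).graph.Adj a b := by
  have hab : (G.layeredInstance k hk hn).edge ⟨e, he⟩ = (a, b) :=
    Prod.ext (Fin.ext ha.symm) (Fin.ext hb.symm)
  refine ⟨fun h => (G.layeredInstance k hk hn).edge_ne ⟨e, he⟩ ?_, Or.inl ⟨⟨e, he⟩, hab⟩⟩
  rw [hab]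
  exact h

theorem layeredInstance_adj_layer (hk : 1 ≤ k) (hn : 1 ≤ n)
    (a b : Fin (G.layeredInstance k hk hn).n) (h : (G.layeredInstance k hk hn).graph.Adj a b) :
    (b : ℕ) / (2 * n) ^ (2 * k) % (2 * k + 2) = (a : ℕ) / (2 * n) ^ (2 * k) % (2 * k + 2) + 1 ∨
    (a : ℕ) / (2 * n) ^ (2 * k) % (2 * k + 2) = (b : ℕ) / (2 * n) ^ (2 * k) % (2 * k + 2) + 1 := by
  obtain ⟨e, he, ⟨ha, hb⟩ | ⟨hb, ha⟩⟩ := G.layeredInstance_adj k hk hn h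
  · left
    rw [ha, hb, G.layeredTail_layer k hn he, G.layeredHead_layer k hn he]
  · right
    rw [ha, hb, G.layeredTail_layer k hn he, G.layeredHead_layer k hn he]

end SimpleGraph

/-! ### Cliques versus short distances in the layered graph -/

namespace SimpleGraph

variable {n : ℕ} (G : SimpleGraph (Fin n)) (k : ℕ)

theorem layeredInstance_edist_le_of_isNClique (hk : 1 ≤ k) (hn : 1 ≤ n) {s : Finset (Fin n)}
    (hs : G.IsNClique (4 * k + 2) s) :
    ∃ i, (G.layeredInstance k hk hn).graph.edist ((G.layeredInstance k hk hn).pair i).1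
      ((G.layeredInstance k hk hn).pair i).2 ≤ (2 * k + 1 : ℕ) := by
  let f := s.orderEmbOfFin hs.card_eq
  -- The clique listed cyclically; window `g` starts at position `2 * g`.
  let z : ℕ → ℕ := fun i => f ⟨i % (4 * k + 2), Nat.mod_lt _ (by omega)⟩
  have hzn : ∀ i, z i < n := fun i => Fin.is_lt _
  have hz : ∀ i, z i < 2 * n := fun i => (hzn i).trans_le (by omega)
  have hper : ∀ i, z (i + (4 * k + 2)) = z i := fun i => by simp [z]
  have hadj : ∀ i j, i < j → j < i + (4 * k + 2) → G.AdjNat (z i) (z j) := by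
    intro i j hij hj
    refine ⟨hzn i, hzn j, hs.isClique (s.orderEmbOfFin_mem hs.card_eq _)
      (s.orderEmbOfFin_mem hs.card_eq _) ?_⟩
    intro h
    have h' := congrArg Fin.val (f.injective h)
    change i % (4 * k + 2) = j % (4 * k + 2) at h'
    obtain ⟨d, rfl⟩ := Nat.exists_eq_add_of_lt hij
    have h3 : d + 1 ≡ 0 [MOD 4 * k + 2] :=
      Nat.ModEq.add_left_cancel' i (by rw [add_zero, ← add_assoc]; exact h'.symm)
    have := Nat.le_of_dvd (by omega) ((Nat.modEq_zero_iff_dvd).1 h3)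
    omega
  have hcode : ∀ g, G.defect (2 * k + 2) (digitNum (2 * n) z (2 * g) (2 * k + 2)) = 0 := by
    intro g
    rw [defect, if_pos]
    have hd : ∀ i < 2 * k + 2,
        digitNum (2 * n) z (2 * g) (2 * k + 2) / (2 * n) ^ i % n = z (2 * g + i) := by
      intro i hi
      rw [← Nat.mod_mod_of_dvd _ (Dvd.intro_left 2 rfl : n ∣ 2 * n), digitNum_digit hz _ hi,
        Nat.mod_eq_of_lt (hzn _)]
    intro i j hij hj
    rw [hd i (hij.trans hj), hd j hj]
    exact hadj _ _ (by omega) (by omega)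
  have hlt : ∀ g, digitNum (2 * n) z (2 * g) (2 * k + 2) < (2 * n) ^ (2 * k + 2) :=
    fun g => digitNum_lt hz _ _
  have hpos : 0 < (2 * n) ^ (2 * k + 2) := by positivity
  -- The number of the edge with gap `g` whose code is the window of `2k+2` clique vertices from
  -- position `2 * g`.
  let e : ℕ → ℕ := fun g => (2 * n) ^ (2 * k + 2) * g + digitNum (2 * n) z (2 * g) (2 * k + 2)
  have hediv : ∀ g, e g / (2 * n) ^ (2 * k + 2) = g := fun g => by
    rw [Nat.mul_add_div hpos, Nat.div_eq_of_lt (hlt g), add_zero]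
  have hemod : ∀ g, e g % (2 * n) ^ (2 * k + 2) = digitNum (2 * n) z (2 * g) (2 * k + 2) :=
    fun g => by rw [Nat.mul_add_mod, Nat.mod_eq_of_lt (hlt g)]
  have he : ∀ g < 2 * k + 1, e g < (2 * k + 1) * (2 * n) ^ (2 * k + 2) := by
    intro g hg
    rw [← Nat.div_lt_iff_lt_mul hpos, hediv]
    exact hg
  have hx : ∀ g, digitNum (2 * n) z (2 * g) (2 * k) < (2 * n) ^ (2 * k) :=
    fun g => digitNum_lt hz _ _
  let v : ℕ → ℕ := fun g =>
    layerNode (2 * k + 2) ((2 * n) ^ (2 * k)) 0 g (digitNum (2 * n) z (2 * g) (2 * k))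
  have htail : ∀ g, v g = G.layeredTail k (e g) := by
    intro g
    rw [layeredTail, hediv, hemod, hcode, digitNum_mod hz _ (by omega)]
  have hhead : ∀ g, v (g + 1) = G.layeredHead k (e g) := by
    intro g
    rw [layeredHead, hediv, hemod, hcode, show digitNum (2 * n) z (2 * g) (2 * k + 2) =
      digitNum (2 * n) z (2 * g) (2 + 2 * k) by rw [add_comm], digitNum_div hz]
    rfl
  have hv : ∀ g, g < 2 * k + 2 → v g < (G.layeredInstance k hk hn).n := fun g hg =>
    (layerNode_lt (by omega) hg (hx g)).trans_le (layered_card_le k hn)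
  have hdist : ∀ g (hg : g < 2 * k + 2), (G.layeredInstance k hk hn).graph.edist
      ⟨v 0, hv 0 (by omega)⟩ ⟨v g, hv g hg⟩ ≤ (g : ℕ) := by
    intro g
    induction g with
    | zero => intro _; simp
    | succ g ih =>
      intro hg
      have hstep : (G.layeredInstance k hk hn).graph.Adj ⟨v g, hv g (by omega)⟩
          ⟨v (g + 1), hv (g + 1) hg⟩ :=
        G.layeredInstance_adj_of_edge k hk hn (he g (by omega)) (htail g) (hhead g)
      refine (SimpleGraph.edist_triangle (v := ⟨v g, hv g (by omega)⟩)).trans ?_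
      rw [Nat.cast_succ]
      exact add_le_add (ih (by omega)) (SimpleGraph.edist_eq_one_iff_adj.2 hstep).le
  refine ⟨⟨digitNum (2 * n) z (2 * 0) (2 * k), hx 0⟩, ?_⟩
  -- After `2k+1` shifts by two positions the window has made one full turn, so the walk ends at the
  -- partner of its start.
  have hlast : digitNum (2 * n) z (2 * (2 * k + 1)) (2 * k) = digitNum (2 * n) z (2 * 0) (2 * k) := by
    rw [show 2 * (2 * k + 1) = 2 * 0 + (4 * k + 2) by ring, digitNum_periodic hper]
  have hpair : (⟨v (2 * k + 1), hv _ (by omega)⟩ : Fin (G.layeredInstance k hk hn).n) =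
      ((G.layeredInstance k hk hn).pair ⟨digitNum (2 * n) z (2 * 0) (2 * k), hx 0⟩).2 :=
    Fin.ext (congrArg (layerNode (2 * k + 2) ((2 * n) ^ (2 * k)) 0 (2 * k + 1)) hlast)
  rw [← hpair]
  exact hdist (2 * k + 1) (by omega)

/-- A cyclic sequence of overlapping codes of cliques yields a clique. -/
theorem exists_isNClique_of_overlap (hn : 1 ≤ n) {t : ℕ → ℕ}
    (hper : ∀ g, t (g + (2 * k + 1)) = t g)
    (ht : ∀ g, t g / (2 * n) ^ 2 = t (g + 1) % (2 * n) ^ (2 * k))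
    (hcode : ∀ g, G.IsCliqueCode (2 * k + 2) (t g)) :
    ∃ s : Finset (Fin n), G.IsNClique (4 * k + 2) s := by
  let z : ℕ → ℕ → ℕ := fun g r => t g / (2 * n) ^ r % n
  have hz : ∀ g h r, h ≤ k → r < 2 → t g / (2 * n) ^ (2 * h + r) % n = z (g + h) r := by
    intro g h r hh hr
    -- A block of two digits is one digit in base `(2n)^2`.
    have key := div_pow_mod_of_overlap (Q := (2 * n) ^ 2) (k := k) (t := t)
      (by intro g; rw [ht, ← pow_mul]) hh g
    have hd : ∀ a : ℕ, a / (2 * n) ^ r % n = a % (2 * n) ^ 2 / (2 * n) ^ r % n := by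
      intro a
      obtain ⟨l, hl⟩ := Nat.exists_eq_add_of_lt hr
      rw [show (2 * n) ^ 2 = (2 * n) ^ (r + (l + 1)) by rw [hl, add_assoc], pow_add, Nat.mod_mul_right_div_self,
        Nat.mod_mod_of_dvd]
      exact (Dvd.intro_left 2 rfl : n ∣ 2 * n).trans (dvd_pow_self _ (by omega))
    change _ = t (g + h) / (2 * n) ^ r % n
    rw [pow_add, ← Nat.div_div_eq_div_mul, pow_mul, hd, key, ← hd]
  have hzper : ∀ g r, z (g + (2 * k + 1)) r = z g r := fun g r => by simp only [z, hper]
  have hwin : ∀ g h r r', h ≤ k → r < 2 → r' < 2 → (h = 0 → r < r') →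
      G.AdjNat (z g r) (z (g + h) r') := by
    intro g h r r' hh hr hr' hne
    have := hcode g r (2 * h + r') (by omega) (by omega)
    rwa [hz g h r' hh hr'] at this
  have hlt : ∀ g g' r r', g ≤ g' → g' < 2 * k + 1 → r < 2 → r' < 2 → (g = g' → r < r') →
      G.AdjNat (z g r) (z g' r') := by
    intro g g' r r' hg hg' hr hr' hne
    -- If going from block `g` up to `g'` takes more than `k` steps, going on from `g'` around the
    -- cycle to `g` takes at most `k`, and adjacency is symmetric.
    by_cases hh : g' - g ≤ k
    · have := hwin g (g' - g) r r' hh hr hr' (by omega)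
      rwa [show g + (g' - g) = g' by omega] at this
    · have := hwin g' (2 * k + 1 + g - g') r' r (by omega) hr' hr (by omega)
      rw [show g' + (2 * k + 1 + g - g') = g + (2 * k + 1) by omega, hzper] at this
      exact this.symm
  let f : Fin (4 * k + 2) → Fin n := fun a => ⟨z (a / 2) (a % 2), Nat.mod_lt _ hn⟩
  have hf' : ∀ a b : Fin (4 * k + 2), a < b → G.Adj (f a) (f b) := by
    intro a b hab
    have hab' : (a : ℕ) < b := hab
    exact (hlt (a / 2) (b / 2) (a % 2) (b % 2) (by omega) (by omega) (by omega) (by omega)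
      (by omega)).2.2
  have hf : ∀ a b : Fin (4 * k + 2), a ≠ b → G.Adj (f a) (f b) := fun a b hab =>
    hab.lt_or_gt.elim (hf' a b) fun h => (hf' b a h).symm
  have hinj : Function.Injective f := fun a b h => by
    by_contra hab
    exact (hf a b hab).ne h
  refine ⟨Finset.univ.map ⟨f, hinj⟩, ⟨?_, by simp⟩⟩
  intro x hx y hy hxy
  obtain ⟨a, -, rfl⟩ := Finset.mem_map.1 hx
  obtain ⟨b, -, rfl⟩ := Finset.mem_map.1 hy
  exact hf a b fun h => hxy (by rw [h])

theorem exists_isNClique_of_layeredInstance_edist_lt (hk : 1 ≤ k) (hn : 1 ≤ n)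
    {i : Fin (G.layeredInstance k hk hn).p}
    (hi : (G.layeredInstance k hk hn).graph.edist ((G.layeredInstance k hk hn).pair i).1
      ((G.layeredInstance k hk hn).pair i).2 < (2 * k + 3 : ℕ)) :
    ∃ s : Finset (Fin n), G.IsNClique (4 * k + 2) s := by
  obtain ⟨p, hp⟩ := SimpleGraph.exists_walk_of_edist_ne_top hi.ne_top
  rw [← hp, Nat.cast_lt] at hi
  have hL := G.layeredInstance_adj_layer k hk hn
  have hx : (i : ℕ) < (2 * n) ^ (2 * k) := i.2
  have hs : ((((G.layeredInstance k hk hn).pair i).1 : Fin _) : ℕ) =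
    layerNode (2 * k + 2) ((2 * n) ^ (2 * k)) 0 0 i := rfl
  have ht : ((((G.layeredInstance k hk hn).pair i).2 : Fin _) : ℕ) =
    layerNode (2 * k + 2) ((2 * n) ^ (2 * k)) 0 (2 * k + 1) i := rfl
  have hLs := layerNode_layer (r := 2 * k + 2) (b := 0) (g := 0) (by omega) hx
  have hLt := layerNode_layer (r := 2 * k + 2) (b := 0) (g := 2 * k + 1) (by omega) hx
  rw [← hs] at hLs
  rw [← ht] at hLt
  -- The length is odd, at least `2k+1` and less than `2k+3`.
  have hlen : p.length = 2 * k + 1 := by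
    have := p.layer_bounds (L := fun v : Fin (G.layeredInstance k hk hn).n => (v : ℕ) / (2 * n) ^ (2 * k) % (2 * k + 2)) hL
    simp only [hLs, hLt] at this
    omega
  have hlayer : ∀ g ≤ 2 * k + 1,
      (p.getVert g : ℕ) / (2 * n) ^ (2 * k) % (2 * k + 2) = g := by
    intro g hg
    have := p.layer_getVert (L := fun v : Fin (G.layeredInstance k hk hn).n => (v : ℕ) / (2 * n) ^ (2 * k) % (2 * k + 2)) hL
      (by simp only [hLs, hLt, hlen]; omega) (i := g) (by omega)
    simpa only [hLs, zero_add] using this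
  have hedge : ∀ g < 2 * k + 1, ∃ e < (2 * k + 1) * (2 * n) ^ (2 * k + 2),
      (p.getVert g : ℕ) = G.layeredTail k e ∧ (p.getVert (g + 1) : ℕ) = G.layeredHead k e := by
    intro g hg
    obtain ⟨e, he, h | ⟨h1, h2⟩⟩ := G.layeredInstance_adj k hk hn
      (p.adj_getVert_succ (i := g) (by omega))
    · exact ⟨e, he, h⟩
    · have a1 := G.layeredTail_layer k hn he
      have a2 := G.layeredHead_layer k hn he
      rw [← h1, hlayer _ (by omega)] at a1
      rw [← h2, hlayer _ (by omega)] at a2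
      omega
  choose! e he htail hhead using hedge
  -- Both ends of an edge lie in the copy given by its defect, so the walk never leaves copy 0 and
  -- uses only codes of cliques.
  have hcopy : ∀ g ≤ 2 * k + 1,
      (p.getVert g : ℕ) / (2 * n) ^ (2 * k) / (2 * k + 2) = 0 := by
    intro g
    induction g with
    | zero =>
      intro _
      rw [p.getVert_zero, hs, layerNode_copy (by omega) hx]
    | succ g ih =>
      intro hg
      have h1 := ih (by omega)
      rw [htail g (by omega), G.layeredTail_copy k hn (he g (by omega))] at h1
      rw [hhead g (by omega), G.layeredHead_copy k hn (he g (by omega)), h1]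
  let t : ℕ → ℕ := fun g => e (g % (2 * k + 1)) % (2 * n) ^ (2 * k + 2)
  have hmod : ∀ g, g % (2 * k + 1) < 2 * k + 1 := fun g => Nat.mod_lt _ (by omega)
  refine G.exists_isNClique_of_overlap k hn (t := t) (fun g => by simp [t]) (fun g => ?_)
    (fun g => ?_)
  · rw [← G.layeredHead_mod k hn, ← hhead _ (hmod g), ← G.layeredTail_mod k hn,
      ← htail _ (hmod _)]
    -- At the wrap-around, the overlap comes from the two ends of the pair carrying the same window.
    by_cases hg : g % (2 * k + 1) = 2 * k
    · have h2 : (g + 1) % (2 * k + 1) = 0 := by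
        rw [Nat.add_mod, hg, Nat.mod_eq_of_lt (show 1 < 2 * k + 1 by omega), Nat.mod_self]
      rw [h2, hg, ← hlen, p.getVert_length, p.getVert_zero, hs, ht, layerNode_mod hx,
        layerNode_mod hx]
    · have h2 : (g + 1) % (2 * k + 1) = g % (2 * k + 1) + 1 := by
        have := hmod g
        rw [Nat.add_mod, Nat.mod_eq_of_lt (show 1 < 2 * k + 1 by omega), Nat.mod_eq_of_lt]
        omega
      rw [h2]
  · by_contra hbad
    have h1 := hcopy _ (hmod g).le
    rw [htail _ (hmod g), G.layeredTail_copy k hn (he _ (hmod g)), defect, if_neg hbad] at h1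
    omega

end SimpleGraph

/-! ### Local maps for arithmetic -/

namespace LocalMap

/-- `if c then a else b`, for a condition `c` with value `0` or `1`. -/
def mux (c a b : LocalMap) : LocalMap :=
  op .add (op .mul c a) (op .mul (op .eq c (const 0)) b)

/-- The `i`-th power. -/
def pow (a : LocalMap) : ℕ → LocalMap
  | 0 => const 1
  | i + 1 => op .mul (pow a i) a

/-- The product of a list of local maps. -/
def prod : List LocalMap → LocalMap
  | [] => const 1
  | a :: l => op .mul a (prod l)

variable {w : ℕ} {x : ℕ → ℕ} {j : ℕ} {a b c : LocalMap} {u v : ℕ}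

theorem eval_const (h : u < 2 ^ w) : (const u).eval w x j = u := Nat.mod_eq_of_lt h

theorem eval_add (ha : a.eval w x j = u) (hb : b.eval w x j = v) (h : u + v < 2 ^ w) :
    (op .add a b).eval w x j = u + v := by
  subst ha hb; exact Nat.mod_eq_of_lt h

theorem eval_mul (ha : a.eval w x j = u) (hb : b.eval w x j = v) (h : u * v < 2 ^ w) :
    (op .mul a b).eval w x j = u * v := by
  subst ha hb; exact Nat.mod_eq_of_lt h

theorem eval_div (ha : a.eval w x j = u) (hb : b.eval w x j = v) (h : u < 2 ^ w) :
    (op .div a b).eval w x j = u / v := by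
  subst ha hb; exact Nat.mod_eq_of_lt ((Nat.div_le_self _ _).trans_lt h)

theorem eval_mod (ha : a.eval w x j = u) (hb : b.eval w x j = v) (h : u < 2 ^ w) :
    (op .mod a b).eval w x j = u % v := by
  subst ha hb; exact Nat.mod_eq_of_lt ((Nat.mod_le _ _).trans_lt h)

theorem eval_sub (ha : a.eval w x j = u) (hb : b.eval w x j = v) (h : u < 2 ^ w) (hvu : v ≤ u) :
    (op .sub a b).eval w x j = u - v := by
  subst ha hb
  change (_ + (2 ^ w - _)) % 2 ^ w = _
  rw [← Nat.add_sub_assoc (hvu.trans h.le), Nat.add_comm, Nat.add_sub_assoc hvu,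
    Nat.add_mod_left]
  exact Nat.mod_eq_of_lt ((Nat.sub_le _ _).trans_lt h)

theorem eval_lt_op (ha : a.eval w x j = u) (hb : b.eval w x j = v) (hw : 1 < 2 ^ w) :
    (op .lt a b).eval w x j = if u < v then 1 else 0 := by
  subst ha hb
  change (if _ then 1 else 0) % 2 ^ w = _
  split_ifs
  · exact Nat.mod_eq_of_lt hw
  · exact Nat.zero_mod _

theorem eval_eq_op (ha : a.eval w x j = u) (hb : b.eval w x j = v) (hw : 1 < 2 ^ w) :
    (op .eq a b).eval w x j = if u = v then 1 else 0 := by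
  subst ha hb
  change (if _ then 1 else 0) % 2 ^ w = _
  split_ifs
  · exact Nat.mod_eq_of_lt hw
  · exact Nat.zero_mod _

theorem eval_input (ha : a.eval w x j = u) (h : x u < 2 ^ w) : (input a).eval w x j = x u := by
  subst ha; exact Nat.mod_eq_of_lt h

/-- The rejected branch is multiplied by `0`, so its value is irrelevant and no overflow occurs. -/
theorem eval_mux {p : Prop} [Decidable p] (hc : c.eval w x j = if p then 1 else 0)
    (hw : 1 < 2 ^ w) (hj : j < 2 ^ w) :
    (mux c a b).eval w x j = if p then a.eval w x j else b.eval w x j := by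
  have ha := a.eval_lt (x := x) hj
  have hb := b.eval_lt (x := x) hj
  have h0 := eval_eq_op hc (eval_const (x := x) (j := j) (show 0 < 2 ^ w by omega)) hw
  by_cases hp : p
  · rw [if_pos hp] at hc h0 ⊢
    rw [if_neg one_ne_zero] at h0
    have h2 := eval_mul hc rfl (by rwa [one_mul]) (b := a)
    have h3 := eval_mul h0 rfl (by omega) (b := b)
    rw [mux, eval_add h2 h3 (by omega)]
    omega
  · rw [if_neg hp] at hc h0 ⊢
    rw [if_pos rfl] at h0
    have h2 := eval_mul hc rfl (by omega) (b := a)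
    have h3 := eval_mul h0 rfl (by rwa [one_mul]) (b := b)
    rw [mux, eval_add h2 h3 (by omega)]
    omega

theorem eval_pow (ha : a.eval w x j = u) (hu : 1 ≤ u) {i : ℕ} (h : u ^ i < 2 ^ w) :
    (a.pow i).eval w x j = u ^ i := by
  induction i with
  | zero => exact eval_const h
  | succ i ih => exact eval_mul (ih ((Nat.pow_le_pow_right hu (by omega)).trans_lt h)) ha h

open Classical in
theorem eval_prod (hw : 1 < 2 ^ w) {ι : Type*} {f : ι → LocalMap} {p : ι → Prop} (l : List ι)
    (hf : ∀ i ∈ l, (f i).eval w x j = if p i then 1 else 0) :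
    (prod (l.map f)).eval w x j = if ∀ i ∈ l, p i then 1 else 0 := by
  induction l with
  | nil =>
    rw [if_pos (by simp)]
    exact eval_const hw
  | cons i l ih =>
    have h1 := hf i (by simp)
    have h2 := ih fun i' hi' => hf i' (by simp [hi'])
    rw [List.map_cons, prod, eval_mul h1 h2]
    · by_cases hi : p i <;> by_cases hl : ∀ i' ∈ l, p i' <;> simp [hi, hl]
    · split_ifs <;> omega

end LocalMap

/-! ### The words of the layered instance -/

theorem encodeGraph_zero {n : ℕ} (G : SimpleGraph (Fin n)) : encodeGraph G 0 = n := rfl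

open Classical in
theorem encodeGraph_adj {n : ℕ} (G : SimpleGraph (Fin n)) {a b : ℕ} (ha : a < n) (hb : b < n) :
    encodeGraph G (1 + a * n + b) = if G.AdjNat a b then 1 else 0 := by
  unfold encodeGraph
  rw [if_neg (by omega)]
  refine if_congr ⟨?_, ?_⟩ rfl rfl
  · rintro ⟨u, v, huv, h⟩
    have h' : n * a + b = n * u + v := by
      rw [mul_comm n a, mul_comm n u]; omega
    have h1 := congrArg (· / n) h'
    have h2 := congrArg (· % n) h'
    simp only [Nat.mul_add_div (show 0 < n by omega), Nat.div_eq_of_lt hb, Nat.div_eq_of_lt v.2,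
      Nat.mul_add_mod, Nat.mod_eq_of_lt hb, Nat.mod_eq_of_lt v.2, add_zero] at h1 h2
    subst h1 h2
    exact ⟨ha, hb, huv⟩
  · rintro ⟨_, _, h⟩
    exact ⟨_, _, h, rfl⟩

namespace LayeredMap

open LocalMap

/-- The number of vertices of the graph. -/
def card : LocalMap := input (const 0)

/-- Twice the number of vertices of the graph. -/
def base : LocalMap := op .mul (const 2) card

/-- The digit number `i` of `t`, modulo the number of vertices. -/
def digit (t : LocalMap) (i : ℕ) : LocalMap := op .mod (op .div t (base.pow i)) card

/-- The entry of the adjacency matrix that belongs to two digits of `t`. -/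
def adjEntry (t : LocalMap) (q : ℕ × ℕ) : LocalMap :=
  input (op .add (op .add (const 1) (op .mul (digit t q.1) card)) (digit t q.2))

/-- The pairs `i < j` of numbers below `l`. -/
def indexPairs (l : ℕ) : List (ℕ × ℕ) :=
  (List.range l).flatMap fun j => (List.range j).map fun i => (i, j)

/-- The defect of `t`. -/
def defect (l : ℕ) (t : LocalMap) : LocalMap :=
  op .eq (prod ((indexPairs l).map (adjEntry t))) (const 0)

/-- The number of a node. -/
def node (k : ℕ) (b g y : LocalMap) : LocalMap :=
  op .add (op .mul (op .add (op .mul b (const (2 * k + 2))) g) (base.pow (2 * k))) y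

/-- The position of an input word in the list of pairs of vertices. -/
def position : LocalMap := op .div (op .sub arg (const 3)) (const 2)

/-- The code that belongs to the current edge. -/
def code (k : ℕ) : LocalMap := op .mod position (base.pow (2 * k + 2))

/-- The gap between two layers that belongs to the current edge. -/
def gap (k : ℕ) : LocalMap := op .div position (base.pow (2 * k + 2))

/-- The node of the current edge in the lower layer. -/
def tail (k : ℕ) : LocalMap :=
  node k (defect (2 * k + 2) (code k)) (gap k) (op .mod (code k) (base.pow (2 * k)))

/-- The node of the current edge in the upper layer. -/
def head (k : ℕ) : LocalMap :=
  node k (defect (2 * k + 2) (code k)) (op .add (gap k) (const 1))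
    (op .div (code k) (base.pow 2))

/-- The number of vertices of the layered instance. -/
def numVertices (k : ℕ) : LocalMap := op .mul (const (2 * k + 2)) (base.pow (2 * k + 1))

/-- The number of edges of the layered instance. -/
def numEdges (k : ℕ) : LocalMap := op .mul (const (2 * k + 1)) (base.pow (2 * k + 2))

/-- Whether the current word is the second one of its pair. -/
def isFirst : LocalMap := op .eq (op .mod (op .sub arg (const 3)) (const 2)) (const 0)

/-- The input words of the layered instance, from the input words of a graph. -/
def encoding (k : ℕ) : LocalMap :=
  mux (op .eq arg (const 0)) (numVertices k) <|
  mux (op .eq arg (const 1)) (numEdges k) <|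
  mux (op .eq arg (const 2)) (base.pow (2 * k)) <|
  mux (op .lt position (numEdges k)) (mux isFirst (tail k) (head k)) <|
  mux (op .lt (op .sub position (numEdges k)) (base.pow (2 * k)))
    (mux isFirst (node k (const 0) (const 0) (op .sub position (numEdges k)))
      (node k (const 0) (const (2 * k + 1)) (op .sub position (numEdges k))))
    (const 0)

theorem mem_indexPairs {l : ℕ} {q : ℕ × ℕ} : q ∈ indexPairs l ↔ q.1 < q.2 ∧ q.2 < l := by
  obtain ⟨i, j⟩ := q
  simp [indexPairs]
  tauto

/-! ### Values of the local maps on large enough words -/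

variable {n : ℕ} {G : SimpleGraph (Fin n)} {k w j : ℕ}

/-- The bound `hw` is the single source of all overflow estimates below. -/
theorem pow_lt (hn : 1 ≤ n) (hw : (4 * k + 8) * (2 * n) ^ (2 * k + 2) < 2 ^ w) {i : ℕ}
    (hi : i ≤ 2 * k + 2) : (4 * k + 8) * (2 * n) ^ i < 2 ^ w :=
  (Nat.mul_le_mul_left _ (Nat.pow_le_pow_right (by omega) hi)).trans_lt hw

theorem const_lt (hn : 1 ≤ n) (hw : (4 * k + 8) * (2 * n) ^ (2 * k + 2) < 2 ^ w) :
    4 * k + 8 < 2 ^ w := by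
  simpa using pow_lt hn hw (Nat.zero_le _)

theorem eval_card (hn : 1 ≤ n) (hw : (4 * k + 8) * (2 * n) ^ (2 * k + 2) < 2 ^ w) :
    card.eval w (encodeGraph G) j = n := by
  have h1 := pow_lt hn hw (i := 1) (by omega)
  rw [pow_one] at h1
  exact eval_input (eval_const (by omega)) (by rw [encodeGraph_zero]; nlinarith)

theorem eval_base (hn : 1 ≤ n) (hw : (4 * k + 8) * (2 * n) ^ (2 * k + 2) < 2 ^ w) :
    base.eval w (encodeGraph G) j = 2 * n := by
  have h1 := pow_lt hn hw (i := 1) (by omega)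
  rw [pow_one] at h1
  have h2 := const_lt hn hw
  exact eval_mul (eval_const (by omega)) (eval_card hn hw) (by nlinarith)

theorem eval_base_pow (hn : 1 ≤ n) (hw : (4 * k + 8) * (2 * n) ^ (2 * k + 2) < 2 ^ w) {i : ℕ}
    (hi : i ≤ 2 * k + 2) : (base.pow i).eval w (encodeGraph G) j = (2 * n) ^ i :=
  eval_pow (eval_base hn hw) (by omega)
    ((Nat.le_mul_of_pos_left _ (by omega)).trans_lt (pow_lt hn hw hi))

theorem eval_digit (hn : 1 ≤ n) (hw : (4 * k + 8) * (2 * n) ^ (2 * k + 2) < 2 ^ w) {t : LocalMap}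
    {u : ℕ} (ht : t.eval w (encodeGraph G) j = u) (hu : u < 2 ^ w) {i : ℕ}
    (hi : i ≤ 2 * k + 2) : (digit t i).eval w (encodeGraph G) j = u / (2 * n) ^ i % n :=
  eval_mod (eval_div ht (eval_base_pow hn hw hi) hu) (eval_card hn hw)
    ((Nat.div_le_self _ _).trans_lt hu)

open Classical in
theorem eval_adjEntry (hn : 1 ≤ n) (hw : (4 * k + 8) * (2 * n) ^ (2 * k + 2) < 2 ^ w)
    {t : LocalMap} {u : ℕ} (ht : t.eval w (encodeGraph G) j = u) (hu : u < 2 ^ w) {q : ℕ × ℕ}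
    (h1 : q.1 ≤ 2 * k + 2) (h2 : q.2 ≤ 2 * k + 2) :
    (adjEntry t q).eval w (encodeGraph G) j =
      if G.AdjNat (u / (2 * n) ^ q.1 % n) (u / (2 * n) ^ q.2 % n) then 1 else 0 := by
  have hc := const_lt hn hw
  have ha := Nat.mod_lt (u / (2 * n) ^ q.1) hn
  have hb := Nat.mod_lt (u / (2 * n) ^ q.2) hn
  have hpow := pow_lt hn hw (i := 2) (by omega)
  have hlt : 1 + u / (2 * n) ^ q.1 % n * n + u / (2 * n) ^ q.2 % n < 2 ^ w := by
    have h3 : (u / (2 * n) ^ q.1 % n + 1) * n ≤ n * n := Nat.mul_le_mul_right _ ha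
    nlinarith
  have he := eval_add (eval_add (eval_const (by omega))
    (eval_mul (eval_digit hn hw ht hu h1) (eval_card hn hw) (by omega)) (by omega))
    (eval_digit hn hw ht hu h2) hlt
  rw [adjEntry, eval_input he, encodeGraph_adj G ha hb]
  rw [encodeGraph_adj G ha hb]
  split_ifs <;> omega

/-- The product of the adjacency entries over all pairs of digits is `1` exactly for codes of
cliques; comparing it with `0` negates it. -/
theorem eval_defect (hn : 1 ≤ n) (hw : (4 * k + 8) * (2 * n) ^ (2 * k + 2) < 2 ^ w)
    {t : LocalMap} {u : ℕ} (ht : t.eval w (encodeGraph G) j = u) (hu : u < 2 ^ w) :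
    (defect (2 * k + 2) t).eval w (encodeGraph G) j = G.defect (2 * k + 2) u := by
  classical
  have hc := const_lt hn hw
  have h1 := eval_prod (w := w) (x := encodeGraph G) (j := j) (by omega) (indexPairs (2 * k + 2))
    (f := adjEntry t) (p := fun q => G.AdjNat (u / (2 * n) ^ q.1 % n) (u / (2 * n) ^ q.2 % n))
    (fun q hq => eval_adjEntry hn hw ht hu (by have := mem_indexPairs.1 hq; omega)
      (by have := mem_indexPairs.1 hq; omega))
  have h2 : (∀ q ∈ indexPairs (2 * k + 2),
      G.AdjNat (u / (2 * n) ^ q.1 % n) (u / (2 * n) ^ q.2 % n)) ↔ G.IsCliqueCode (2 * k + 2) u :=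
    ⟨fun h a b hab hb => h (a, b) (mem_indexPairs.2 ⟨hab, hb⟩),
      fun h q hq => h _ _ (mem_indexPairs.1 hq).1 (mem_indexPairs.1 hq).2⟩
  rw [defect, eval_eq_op h1 (eval_const (by omega)) (by omega), SimpleGraph.defect]
  by_cases hh : G.IsCliqueCode (2 * k + 2) u
  · rw [if_pos hh, if_pos (h2.2 hh), if_neg one_ne_zero]
  · rw [if_neg hh, if_neg (fun h => hh (h2.1 h)), if_pos rfl]

theorem eval_node (hn : 1 ≤ n) (hw : (4 * k + 8) * (2 * n) ^ (2 * k + 2) < 2 ^ w)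
    {b g y : LocalMap} {b' g' y' : ℕ} (hb : b.eval w (encodeGraph G) j = b')
    (hg : g.eval w (encodeGraph G) j = g') (hy : y.eval w (encodeGraph G) j = y')
    (hb' : b' ≤ 1) (hg' : g' < 2 * k + 2) (hy' : y' < (2 * n) ^ (2 * k)) :
    (node k b g y).eval w (encodeGraph G) j =
      layerNode (2 * k + 2) ((2 * n) ^ (2 * k)) b' g' y' := by
  have hc := const_lt hn hw
  have h1 : b' * (2 * k + 2) ≤ 1 * (2 * k + 2) := Nat.mul_le_mul_right _ hb'
  have h2 := (layerNode_lt hb' hg' hy').trans_le (show 2 * (2 * k + 2) * (2 * n) ^ (2 * k) ≤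
    (4 * k + 8) * (2 * n) ^ (2 * k) by gcongr; omega)
  have h3 := h2.trans (pow_lt hn hw (i := 2 * k) (by omega))
  have h4 := h3
  unfold layerNode at h4
  exact eval_add (eval_mul (eval_add (eval_mul hb (eval_const (by omega)) (by omega)) hg
    (by omega)) (eval_base_pow hn hw (by omega)) (by omega)) hy h3

theorem eval_position (hn : 1 ≤ n) (hw : (4 * k + 8) * (2 * n) ^ (2 * k + 2) < 2 ^ w)
    (hj : j < 2 ^ w) (h3 : 3 ≤ j) :
    position.eval w (encodeGraph G) j = (j - 3) / 2 := by
  have hc := const_lt hn hw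
  exact eval_div (eval_sub rfl (eval_const (by omega)) hj h3) (eval_const (by omega))
    ((Nat.sub_le _ _).trans_lt hj)

theorem eval_isFirst (hn : 1 ≤ n) (hw : (4 * k + 8) * (2 * n) ^ (2 * k + 2) < 2 ^ w)
    (hj : j < 2 ^ w) (h3 : 3 ≤ j) :
    isFirst.eval w (encodeGraph G) j = if (j - 3) % 2 = 0 then 1 else 0 := by
  have hc := const_lt hn hw
  exact eval_eq_op (eval_mod (eval_sub rfl (eval_const (by omega)) hj h3) (eval_const (by omega))
    ((Nat.sub_le _ _).trans_lt hj)) (eval_const (by omega)) (by omega)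

theorem eval_code (hn : 1 ≤ n) (hw : (4 * k + 8) * (2 * n) ^ (2 * k + 2) < 2 ^ w)
    (hj : j < 2 ^ w) (h3 : 3 ≤ j) : (code k).eval w (encodeGraph G) j =
      (j - 3) / 2 % (2 * n) ^ (2 * k + 2) :=
  eval_mod (eval_position hn hw hj h3) (eval_base_pow hn hw le_rfl) (by omega)

theorem eval_gap (hn : 1 ≤ n) (hw : (4 * k + 8) * (2 * n) ^ (2 * k + 2) < 2 ^ w)
    (hj : j < 2 ^ w) (h3 : 3 ≤ j) : (gap k).eval w (encodeGraph G) j =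
      (j - 3) / 2 / (2 * n) ^ (2 * k + 2) :=
  eval_div (eval_position hn hw hj h3) (eval_base_pow hn hw le_rfl) (by omega)

theorem eval_tail (hn : 1 ≤ n) (hw : (4 * k + 8) * (2 * n) ^ (2 * k + 2) < 2 ^ w)
    (hj : j < 2 ^ w) (h3 : 3 ≤ j) (he : (j - 3) / 2 < (2 * k + 1) * (2 * n) ^ (2 * k + 2)) :
    (tail k).eval w (encodeGraph G) j = G.layeredTail k ((j - 3) / 2) := by
  have ht : (j - 3) / 2 % (2 * n) ^ (2 * k + 2) < 2 ^ w :=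
    (Nat.mod_le _ _).trans_lt (by omega)
  have hg := SimpleGraph.layered_gap_lt k he
  exact eval_node hn hw (eval_defect hn hw (eval_code hn hw hj h3) ht) (eval_gap hn hw hj h3)
    (eval_mod (eval_code hn hw hj h3) (eval_base_pow hn hw (by omega)) ht)
    (G.defect_le_one _ _) (by omega) (SimpleGraph.layeredTail_index_lt k hn _)

theorem eval_head (hn : 1 ≤ n) (hw : (4 * k + 8) * (2 * n) ^ (2 * k + 2) < 2 ^ w)
    (hj : j < 2 ^ w) (h3 : 3 ≤ j) (he : (j - 3) / 2 < (2 * k + 1) * (2 * n) ^ (2 * k + 2)) :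
    (head k).eval w (encodeGraph G) j = G.layeredHead k ((j - 3) / 2) := by
  have hc := const_lt hn hw
  have ht : (j - 3) / 2 % (2 * n) ^ (2 * k + 2) < 2 ^ w :=
    (Nat.mod_le _ _).trans_lt (by omega)
  have hg := SimpleGraph.layered_gap_lt k he
  exact eval_node hn hw (eval_defect hn hw (eval_code hn hw hj h3) ht)
    (eval_add (eval_gap hn hw hj h3) (eval_const (by omega)) (by omega))
    (eval_div (eval_code hn hw hj h3) (eval_base_pow hn hw (by omega)) ht)
    (G.defect_le_one _ _) (by omega) (SimpleGraph.layeredHead_index_lt k hn _)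

theorem eval_numEdges (hn : 1 ≤ n) (hw : (4 * k + 8) * (2 * n) ^ (2 * k + 2) < 2 ^ w) :
    (numEdges k).eval w (encodeGraph G) j = (2 * k + 1) * (2 * n) ^ (2 * k + 2) := by
  have hc := const_lt hn hw
  refine eval_mul (eval_const (by omega)) (eval_base_pow hn hw le_rfl) ?_
  exact (Nat.mul_le_mul_right _ (by omega)).trans_lt hw

theorem eval_numVertices (hn : 1 ≤ n) (hw : (4 * k + 8) * (2 * n) ^ (2 * k + 2) < 2 ^ w) :
    (numVertices k).eval w (encodeGraph G) j = (2 * k + 2) * (2 * n) ^ (2 * k + 1) := by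
  have hc := const_lt hn hw
  refine eval_mul (eval_const (by omega)) (eval_base_pow hn hw (by omega)) ?_
  exact (Nat.mul_le_mul_right _ (by omega)).trans_lt (pow_lt hn hw (by omega))

theorem eval_encoding (hk : 1 ≤ k) (hn : 1 ≤ n)
    (hw : (4 * k + 8) * (2 * n) ^ (2 * k + 2) < 2 ^ w) (hj : j < 2 ^ w) :
    (encoding k).eval w (encodeGraph G) j = (G.layeredInstance k hk hn).encode j % 2 ^ w := by
  have hc := const_lt hn hw
  have h1w : 1 < 2 ^ w := by omega
  symm
  rw [← Nat.mod_eq_of_lt (LocalMap.eval_lt hj (encoding k) (x := encodeGraph G))]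
  -- The local map's value is already reduced, so it suffices to match the unreduced words case by
  -- case.
  refine congrArg (· % 2 ^ w) ?_
  have hm : (G.layeredInstance k hk hn).m = (2 * k + 1) * (2 * n) ^ (2 * k + 2) := rfl
  have hp : (G.layeredInstance k hk hn).p = (2 * n) ^ (2 * k) := rfl
  rw [encoding, eval_mux (eval_eq_op rfl (eval_const (by omega)) h1w) h1w hj,
    eval_mux (eval_eq_op rfl (eval_const (by omega)) h1w) h1w hj,
    eval_mux (eval_eq_op rfl (eval_const (by omega)) h1w) h1w hj, PairsInstance.encode]
  change _ = if j = 0 then _ else if j = 1 then _ else if j = 2 then _ else _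
  by_cases h0 : j = 0
  · rw [if_pos h0, if_pos h0]
    exact (eval_numVertices hn hw).symm
  by_cases h1 : j = 1
  · rw [if_neg h0, if_neg h0, if_pos h1, if_pos h1]
    exact (eval_numEdges hn hw).symm
  by_cases h2 : j = 2
  · rw [if_neg h0, if_neg h0, if_neg h1, if_neg h1, if_pos h2, if_pos h2]
    exact (eval_base_pow hn hw (by omega)).symm
  have h3 : 3 ≤ j := by omega
  have hpos := eval_position (G := G) hn hw hj h3
  have hedges := eval_numEdges (G := G) (j := j) hn hw
  have hfirst := eval_isFirst (G := G) hn hw hj h3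
  rw [if_neg h0, if_neg h0, if_neg h1, if_neg h1, if_neg h2, if_neg h2,
    eval_mux (eval_lt_op hpos hedges h1w) h1w hj]
  by_cases he : (j - 3) / 2 < (2 * k + 1) * (2 * n) ^ (2 * k + 2)
  · rw [if_pos he, dif_pos (hm ▸ he), eval_mux hfirst h1w hj, eval_tail hn hw hj h3 he,
      eval_head hn hw hj h3 he]
    rfl
  · have hsub := eval_sub hpos hedges (by omega) (not_lt.1 he)
    rw [if_neg he, dif_neg (hm ▸ he), eval_mux (eval_lt_op hsub
      (eval_base_pow hn hw (by omega)) h1w) h1w hj]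
    by_cases hi : (j - 3) / 2 - (2 * k + 1) * (2 * n) ^ (2 * k + 2) < (2 * n) ^ (2 * k)
    · rw [if_pos hi, dif_pos (hm ▸ hp ▸ hi), eval_mux hfirst h1w hj,
        eval_node hn hw (eval_const (by omega)) (eval_const (by omega)) hsub (by omega) (by omega)
          hi,
        eval_node hn hw (eval_const (by omega)) (eval_const (by omega)) hsub (by omega) (by omega)
          hi]
      rfl
    · rw [if_neg hi, dif_neg (hm ▸ hp ▸ hi), eval_const (by omega)]

end LayeredMap

/-! ### The reduction -/

namespace SimpleGraph

variable {n : ℕ} (G : SimpleGraph (Fin n)) {k : ℕ}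

/-- Outputs are shifted by one and `0` encodes `∞`, so the test accepts exactly the finite estimates
below `2k+3`, the least possible distance without a clique. -/
theorem lt_of_isApprox_layeredInstance (hk : 1 ≤ k) (hn : 1 ≤ n) {α : ℝ}
    (hα : α < 1 + 1 / ((k : ℝ) + 0.5)) {v : ℕ}
    (hv : IsApprox α (G.layeredInstance k hk hn).minDist (decodeDist v)) :
    (0 < v ∧ v < 2 * k + 4) ↔ ∃ s : Finset (Fin n), G.IsNClique (4 * k + 2) s := by
  constructor
  · rintro ⟨h0, hlt⟩
    by_contra hG
    have hle : ((2 * k + 3 : ℕ) : ℕ∞) ≤ (G.layeredInstance k hk hn).minDist := by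
      refine le_iInf fun i => ?_
      by_contra hi
      exact hG (G.exists_isNClique_of_layeredInstance_edist_lt k hk hn (not_le.1 hi))
    obtain ⟨u, rfl⟩ := Nat.exists_eq_succ_of_ne_zero h0.ne'
    have h1 : ((2 * k + 3 : ℕ) : ℕ∞) ≤ (u : ℕ) := hle.trans hv.1
    rw [Nat.cast_le] at h1
    omega
  · rintro ⟨s, hs⟩
    obtain ⟨i, hi⟩ := G.layeredInstance_edist_le_of_isNClique k hk hn hs
    have hle : (G.layeredInstance k hk hn).minDist ≤ (2 * k + 1 : ℕ) := (iInf_le _ i).trans hi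
    obtain ⟨d, hd⟩ := ENat.ne_top_iff_exists.1 (ne_top_of_le_ne_top (ENat.natCast_ne_top _) hle)
    rw [← hd, Nat.cast_le] at hle
    obtain ⟨e, he, hed⟩ := hv.2 d hd.symm
    cases v with
    | zero => exact absurd he.symm (ENat.natCast_ne_top e)
    | succ u =>
      have hue : u = e := Nat.cast_injective (R := ℕ∞) he
      subst hue
      have hd' : (d : ℝ) ≤ 2 * k + 1 := by exact_mod_cast hle
      have hk0 : (0 : ℝ) ≤ k := Nat.cast_nonneg k
      have h1 : α * d ≤ (1 + 1 / ((k : ℝ) + 0.5)) * d := by gcongr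
      have h2 : (1 + 1 / ((k : ℝ) + 0.5)) * d ≤ (1 + 1 / ((k : ℝ) + 0.5)) * (2 * k + 1) := by gcongr
      have h3 : (1 + 1 / ((k : ℝ) + 0.5)) * (2 * k + 1) = 2 * k + 3 := by field_simp; ring
      -- The bound on `α` gives a strict inequality after multiplication only if `d > 0`.
      rcases Nat.eq_zero_or_pos d with rfl | hdpos
      · have : (u : ℝ) ≤ 0 := by simpa using hed
        have : u = 0 := by exact_mod_cast le_antisymm this (Nat.cast_nonneg u)
        omega
      · have h4 : α * d < (1 + 1 / ((k : ℝ) + 0.5)) * d := by gcongr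
        have : (u : ℝ) < 2 * k + 3 := by linarith
        have : u < 2 * k + 3 := by exact_mod_cast this
        omega

end SimpleGraph

/-- The test `0 < v < b` for the output `v`. -/
def LocalMap.between (b : ℕ) : LocalMap :=
  op .mul (op .lt (const 0) arg) (op .lt arg (const b))

theorem LocalMap.eval_between_ne_zero {w b v : ℕ} {x : ℕ → ℕ} (hb : b < 2 ^ w) (h1 : 1 < 2 ^ w) :
    (between b).eval w x v ≠ 0 ↔ 0 < v ∧ v < b := by
  have h2 := eval_lt_op (w := w) (x := x) (j := v) (eval_const (by omega : 0 < 2 ^ w))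
    (rfl : arg.eval w x v = v) h1
  have h3 := eval_lt_op (w := w) (x := x) (j := v) (rfl : arg.eval w x v = v) (eval_const hb) h1
  rw [show arg.eval w x v = v from rfl] at h2 h3
  rw [between, eval_mul h2 h3 (by split_ifs <;> omega)]
  by_cases hv : 0 < v <;> by_cases hv' : v < b <;> simp [hv, hv']

theorem layered_size_le (k : ℕ) {n : ℕ} (hn : 1 ≤ n) :
    (4 * k + 8) * (2 * n) ^ (2 * k + 2) ≤ (n + 1) ^ (8 * k + 12) := by
  have h1 : 4 * k + 8 ≤ (n + 1) ^ (4 * k + 8) :=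
    (Nat.lt_two_pow_self).le.trans (Nat.pow_le_pow_left (by omega) _)
  have h2 : 2 * n ≤ (n + 1) ^ 2 := by nlinarith
  calc (4 * k + 8) * (2 * n) ^ (2 * k + 2)
      ≤ (n + 1) ^ (4 * k + 8) * ((n + 1) ^ 2) ^ (2 * k + 2) := by gcongr
    _ = (n + 1) ^ (8 * k + 12) := by rw [← pow_mul, ← pow_add]; congr 1; ring

theorem layered_card_lt_size (k : ℕ) {n : ℕ} (hn : 1 ≤ n) :
    (2 * k + 2) * (2 * n) ^ (2 * k + 1) + 1 ≤ (4 * k + 8) * (2 * n) ^ (2 * k + 2) := by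
  have h1 : 0 < (2 * n) ^ (2 * k + 1) := by positivity
  calc (2 * k + 2) * (2 * n) ^ (2 * k + 1) + 1 ≤ (4 * k + 8) * (2 * n) ^ (2 * k + 1) := by nlinarith
    _ ≤ (4 * k + 8) * (2 * n) ^ (2 * k + 2) := by gcongr <;> omega

/-- A program that approximates the minimum distance of the layered instances in time
`O(n ^ (4 * k + 2 - δ))` refutes the clique hypothesis. -/
theorem CombinatorialCliqueHypothesis.not_approximatesMinDist {𝒞 : Set Program}
    (h𝒞 : ClosedUnderRecoding 𝒞) {k : ℕ} (hk : 1 ≤ k)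
    (hyp : CombinatorialCliqueHypothesis 𝒞 (4 * k + 2)) {C : ℕ} (hC : 1 ≤ C) {α : ℝ}
    (hα : α < 1 + 1 / ((k : ℝ) + 0.5)) {t : ℝ → ℝ → ℝ} {δ L : ℝ} (hδ : 0 < δ)
    (ht0 : ∀ a b : ℝ, 0 ≤ a → 0 ≤ b → 0 ≤ t a b)
    (ht : ∀ n : ℕ, 1 ≤ n → t ((2 * k + 2) * (2 * n) ^ (2 * k + 1))
      ((2 * k + 1) * (2 * n) ^ (2 * k + 2)) ≤ L * (n : ℝ) ^ (4 * (k : ℝ) + 2 - δ)) :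
    ¬ ∃ A ∈ 𝒞, ApproximatesMinDist A C α t := by
  rintro ⟨A, hA, c, K, h⟩
  refine hyp δ hδ ⟨_, h𝒞 A hA (LayeredMap.encoding k) (LocalMap.between (2 * k + 4)),
    -- The layered instance has fewer than `(n+1)^(8k+12)` vertices, whence the factor of `c`; the
    -- summand `8k+13` exceeds `8k+12` by one to make the overflow bound strict.
    8 * k + 13 + (8 * k + 12) * c, |K| * L, ?_⟩
  intro n hn G w hw
  have hsize := layered_size_le k hn
  have hcard := layered_card_lt_size k hn
  have hw1 : (4 * k + 8) * (2 * n) ^ (2 * k + 2) < 2 ^ w :=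
    hsize.trans_lt ((Nat.pow_lt_pow_right (by omega) (by omega)).trans_le hw)
  have hconst := LayeredMap.const_lt hn hw1
  have hw2 : ((2 * k + 2) * (2 * n) ^ (2 * k + 1) + 1) ^ c ≤ 2 ^ w := by
    refine (Nat.pow_le_pow_left (hcard.trans hsize) c).trans ?_
    rw [← pow_mul]
    exact (Nat.pow_le_pow_right (by omega) (by omega)).trans hw
  have hNpos : 1 ≤ (G.layeredInstance k hk hn).n :=
    Nat.succ_le_of_lt (show 0 < (2 * k + 2) * (2 * n) ^ (2 * k + 1) by positivity)
  have hppos : 1 ≤ (G.layeredInstance k hk hn).p :=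
    Nat.succ_le_of_lt (show 0 < (2 * n) ^ (2 * k) by positivity)
  obtain ⟨T, v, hT, hout, happrox⟩ := h (G.layeredInstance k hk hn) hNpos
    (G.layeredInstance_n_le_m k hk hn) hppos
    ((G.layeredInstance_p_le_n k hk hn).trans (Nat.le_mul_of_pos_left _ hC)) w hw2
  refine ⟨T, _, ?_, hout.recode (LocalMap.between (2 * k + 4))
    fun j hj => LayeredMap.eval_encoding hk hn hw1 hj, ?_⟩
  · have hN : ((G.layeredInstance k hk hn).n : ℝ) = (2 * k + 2) * (2 * n) ^ (2 * k + 1) := by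
      change (((2 * k + 2) * (2 * n) ^ (2 * k + 1) : ℕ) : ℝ) = _
      push_cast; rfl
    have hM : ((G.layeredInstance k hk hn).m : ℝ) = (2 * k + 1) * (2 * n) ^ (2 * k + 2) := by
      change (((2 * k + 1) * (2 * n) ^ (2 * k + 2) : ℕ) : ℝ) = _
      push_cast; rfl
    rw [hN, hM] at hT
    push_cast
    calc (T : ℝ) ≤ K * _ := hT
      _ ≤ |K| * _ := mul_le_mul_of_nonneg_right (le_abs_self K)
        (ht0 _ _ (by positivity) (by positivity))
      _ ≤ |K| * (L * (n : ℝ) ^ (4 * (k : ℝ) + 2 - δ)) :=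
        mul_le_mul_of_nonneg_left (ht n hn) (abs_nonneg K)
      _ = _ := by ring
  · rw [LocalMap.eval_between_ne_zero (by omega) (by omega)]
    exact G.lt_of_isApprox_layeredInstance hk hn hα happrox

/-! ### Running times -/

/-- A monomial as a real power. -/
theorem Real.mul_mul_pow (a b : ℝ) (i : ℕ) : a * (2 * b) ^ i = a * 2 ^ i * b ^ (i : ℝ) := by
  rw [mul_pow, ← mul_assoc, Real.rpow_natCast]

/-- A power of a monomial. -/
theorem Real.mul_mul_pow_rpow {a b : ℝ} (ha : 0 ≤ a) (hb : 0 ≤ b) (i : ℕ) (r : ℝ) :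
    (a * (2 * b) ^ i) ^ r = (a * 2 ^ i) ^ r * b ^ (i * r) := by
  rw [Real.mul_mul_pow, Real.mul_rpow (by positivity) (by positivity), ← Real.rpow_mul hb]

theorem mainTheorem4 (𝒞 : Set Program) (h𝒞 : ClosedUnderRecoding 𝒞) (k : ℕ) (hk : 1 ≤ k)
    (hyp : CombinatorialCliqueHypothesis 𝒞 (4 * k + 2))
    (C : ℕ) (hC : 1 ≤ C) (α : ℝ) (hα : α < 1 + 1 / ((k : ℝ) + 0.5)) (ε : ℝ) (hε : 0 < ε) :
    (¬ ∃ A ∈ 𝒞, ApproximatesMinDist A C α (fun n _ => n ^ (2 - ε))) ∧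
    (¬ ∃ A ∈ 𝒞, ApproximatesMinDist A C α (fun n m => m + n ^ (2 - ε))) ∧
    (¬ ∃ A ∈ 𝒞, ApproximatesMinDist A C α
      (fun n m => m * n ^ (1 - 1 / (2 * (k : ℝ) + 1) - ε))) ∧
    (¬ ∃ A ∈ 𝒞, ApproximatesMinDist A C α
      (fun n m => m ^ (2 - 3 / ((k : ℝ) + 2)) * n ^ (2 / ((k : ℝ) + 2) - ε))) := by
  have hk1 : (1 : ℝ) ≤ k := by exact_mod_cast hk
  have hδ : 0 < (2 * (k : ℝ) + 1) * ε := by positivity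
  refine ⟨?_, ?_, ?_, ?_⟩
  · refine hyp.not_approximatesMinDist h𝒞 hk hC hα hδ (fun a b ha hb => by positivity)
      (L := ((2 * k + 2) * 2 ^ (2 * k + 1)) ^ (2 - ε)) fun n hn => le_of_eq ?_
    rw [Real.mul_mul_pow_rpow (by positivity) (by positivity)]
    congr 2
    push_cast
    ring
  -- The term `m` has order `n^(2k+2)`, which is `2k` below the exponent `4k+2`; positivity of this
  -- saving uses `k ≥ 1`.
  · refine hyp.not_approximatesMinDist h𝒞 hk hC hα (δ := min (2 * k) ((2 * k + 1) * ε))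
      (lt_min (by positivity) hδ) (fun a b ha hb => by positivity)
      (L := (2 * k + 1) * 2 ^ (2 * k + 2) + ((2 * k + 2) * 2 ^ (2 * k + 1)) ^ (2 - ε))
      fun n hn => ?_
    have hn1 : (1 : ℝ) ≤ n := by exact_mod_cast hn
    rw [Real.mul_mul_pow_rpow (by positivity) (by positivity), Real.mul_mul_pow, add_mul _ _ ((n : ℝ) ^ _)]
    refine add_le_add (mul_le_mul_of_nonneg_left ?_ (by positivity))
      (mul_le_mul_of_nonneg_left ?_ (by positivity))
    · refine Real.rpow_le_rpow_of_exponent_le hn1 ?_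
      have := min_le_left (2 * (k : ℝ)) ((2 * k + 1) * ε)
      push_cast
      linarith
    · refine Real.rpow_le_rpow_of_exponent_le hn1 ?_
      have := min_le_right (2 * (k : ℝ)) ((2 * k + 1) * ε)
      push_cast
      nlinarith
  · refine hyp.not_approximatesMinDist h𝒞 hk hC hα hδ (fun a b ha hb => by positivity)
      (L := (2 * k + 1) * 2 ^ (2 * k + 2) *
        ((2 * k + 2) * 2 ^ (2 * k + 1)) ^ (1 - 1 / (2 * (k : ℝ) + 1) - ε))
      fun n hn => le_of_eq ?_
    have hn1 : (0 : ℝ) < n := by exact_mod_cast hn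
    rw [Real.mul_mul_pow_rpow (by positivity) (by positivity), Real.mul_mul_pow,
      mul_mul_mul_comm, ← Real.rpow_add hn1]
    -- Exponents: `(2k+2) + (2k+1)(1 - 1/(2k+1) - ε) = 4k+2 - (2k+1)ε`.
    congr 2
    push_cast
    field_simp
    ring
  · refine hyp.not_approximatesMinDist h𝒞 hk hC hα hδ (fun a b ha hb => by positivity)
      (L := ((2 * k + 1) * 2 ^ (2 * k + 2)) ^ (2 - 3 / ((k : ℝ) + 2)) *
        ((2 * k + 2) * 2 ^ (2 * k + 1)) ^ (2 / ((k : ℝ) + 2) - ε))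
      fun n hn => le_of_eq ?_
    have hn1 : (0 : ℝ) < n := by exact_mod_cast hn
    rw [Real.mul_mul_pow_rpow (by positivity) (by positivity),
      Real.mul_mul_pow_rpow (by positivity) (by positivity), mul_mul_mul_comm,
      ← Real.rpow_add hn1]
    -- Exponents: `(2k+2)(2 - 3/(k+2)) + (2k+1)(2/(k+2) - ε) = 4k+2 - (2k+1)ε`, as `2 - 3/(k+2) =
    -- (2k+1)/(k+2)`.
    congr 2
    push_cast
    field_simp
    ring
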